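/- Let $R$ be a finite commutative local ring with Jacobson radical $J$, and let $q, n$ be such that $|R| = q^n$, the residue field $R/J$ has order $q$, and $J^{n-1} \neq 0$. Let $k \ge 0$ and $u \in J^k \setminus J^{k+1}$ (with $J^0 = R$). Let $A_u(R)$ be the $0$–$1$ matrix with rows and columns indexed by the elements of $R$ whose entry at $(x,y)$ is $1$ if $xy = u$ and $0$ otherwise, and let $p(\lambda) = \det(A_u(R) - \lambda I)$ be its characteristic polynomial. (1) If $k$ is odd, then $$p(\lambda) = (-1)^q\,\lambda^{q^{n-k-1}\left(q^{k+1}-(k+1)(q-1)\right)}\,(\lambda^2-q^k)^{q^{n-k-1}(q-1)(k+1)/2}.$$ (2) If $k$ is even, $q$ is odd, and there exists $s \in R$ with $u = s^2$, then $$p(\lambda) = -\lambda^{q^{n-k-1}\left(q^{k+1}-(k+1)(q-1)\right)}\,(\lambda^2-q^k)^{q^{n-k-1}(q-1)(k+1)/2-1}\,(\lambda-q^{k/2})^2.$$ (3) If $k$ is even, $q$ is odd, and there is no $s \in R$ with $u = s^2$, then $$p(\lambda) = -\lambda^{q^{n-k-1}\left(q^{k+1}-(k+1)(q-1)\right)}\,(\lambda^2-q^k)^{q^{n-k-1}(q-1)(k+1)/2}.$$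 (4) If $k$ is even and $q$ is odd, then exactly $q^{n-k-1}(q-1)/2$ elements $v \in J^k \setminus J^{k+1}$ are of the form $v = s^2$ with $s \in R$. -/

import Mathlib

open Polynomial

noncomputable section

/-- The product matrix `A_u(R)` of an element `u` of a finite commutative ring `R`: rows and columns
are indexed by the elements of `R`, and the entry at `(x, y)` is `1` if `x * y = u`, else `0`. -/
def productMatrix (R : Type*) [CommRing R] [DecidableEq R] (u : R) : Matrix R R ℝ :=
  Matrix.of fun x y => if x * y = u then 1 else 0

/-- The characteristic polynomial `p(λ) = det (A - λ I)`. In this sign convention the leading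
coefficient is `(-1)` to the size of `A`; `Matrix.charpoly` is `det (λ I - A)`. -/
def detCharpoly {ι : Type*} [Fintype ι] [DecidableEq ι] (A : Matrix ι ι ℝ) : ℝ[X] :=
  (A.map (C : ℝ →+* ℝ[X]) - (X : ℝ[X]) • (1 : Matrix ι ι ℝ[X])).det

end

/-!
The hypotheses make `R` a finite chain ring of length `n`: each of the `n` quotients
`J ^ i / J ^ (i + 1)` has order at least `q`, and `|R| = q ^ n` forces order exactly `q`
(`IsFiniteChainRing.card_pow`). Call `i` the level of `x` if `x ∈ J ^ i \ J ^ (i + 1)`; such an `x`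
generates `J ^ i` (`span_eq`), its annihilator is `J ^ (n - i)` (`mul_eq_zero_iff`), and levels add
up in nonzero products (`level_right`).

The matrix `A = A_u(R)` is real symmetric, hence diagonalizable, and its spectrum is read off from
three facts.

* `A ^ 3 = q ^ k A` (`productMatrix_cube`), so that the eigenvalues are `0` and `± q ^ (k / 2)`. The
  entry of `A ^ 3` at `(x, w)` counts the paths `x y = y z = z w = u`. Such a path forces `x w = u`,
  and if `x w = u` there are `q ^ k` of them, since `y` and `z` range independently over cosets of
  the annihilators of `x` and `w`.
* `tr A ^ 2` is the number of solutions of `x y = u`; each level `i ≤ k` contributes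
  `q ^ (n - 1) (q - 1)` of them (`sum_ncard_mul_eq`). This gives the number of nonzero eigenvalues.
* `tr A` is the number of square roots of `u`. It is `0` if `u` is not a square, in particular if
  `k` is odd, and `2 q ^ (k / 2)` if `q` is odd and `u` is a square (`ncard_sq_eq`). This gives the
  difference of the multiplicities of `q ^ (k / 2)` and `- q ^ (k / 2)`.

The same count of square roots, applied to every fibre of squaring from level `k / 2` to level `k`,
gives the number of squares of level `k` (`ncard_squares`).
-/

/-! ### Symmetric matrices with three eigenvalues -/

theorem detCharpoly_eq {ι : Type*} [Fintype ι] [DecidableEq ι] (A : Matrix ι ι ℝ) :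
    detCharpoly A = (-1) ^ Fintype.card ι * A.charpoly := by
  rw [detCharpoly, Matrix.charpoly, Matrix.charmatrix, ← Matrix.det_neg]
  congr 1
  ext i j : 1
  by_cases hij : i = j <;> simp [hij, Matrix.smul_apply]

/-- A real symmetric matrix with `A ^ 3 = c ^ 2 A` has eigenvalues `0, c, -c` only, and the traces
of `A` and `A ^ 2` determine their multiplicities. -/
theorem charpoly_eq_of_cube_eq {ι : Type*} [Fintype ι] [DecidableEq ι] {A : Matrix ι ι ℝ}
    (hA : A.IsHermitian) {c : ℝ} (hc : 0 < c) (hcube : A * A * A = c ^ 2 • A) {b t : ℕ}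
    (htr : A.trace = c * t) (htr2 : (A * A).trace = c ^ 2 * (2 * b + t)) :
    A.charpoly = X ^ (Fintype.card ι - (2 * b + t)) * (X ^ 2 - C (c ^ 2)) ^ b *
      (X - C c) ^ t := by
  have hev : ∀ i, hA.eigenvalues i = 0 ∨ hA.eigenvalues i = c ∨ hA.eigenvalues i = -c := by
    intro i
    set μ := hA.eigenvalues i
    set v : ι → ℝ := (hA.eigenvectorBasis i).ofLp
    have hv : A.mulVec v = μ • v := hA.mulVec_eigenvectorBasis i
    have hv0 : v ≠ 0 := fun h0 => by
      have := hA.eigenvectorBasis.orthonormal.ne_zero i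
      exact this (WithLp.ofLp_injective 2 h0)
    have h3 := congrArg (fun M => M.mulVec v) hcube
    simp only [← Matrix.mulVec_mulVec, hv, Matrix.mulVec_smul, Matrix.smul_mulVec, smul_smul] at h3
    have h4 : μ * μ * μ = c ^ 2 * μ := by
      have := sub_eq_zero.2 h3
      rw [← sub_smul] at this
      have := sub_eq_zero.1 ((smul_eq_zero.1 this).resolve_right hv0)
      rwa [← mul_assoc] at this
    have h5 : μ * ((μ - c) * (μ + c)) = 0 := by linear_combination h4
    rcases mul_eq_zero.1 h5 with h | h
    · exact Or.inl h
    · rcases mul_eq_zero.1 h with h | h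
      · exact Or.inr (Or.inl (sub_eq_zero.1 h))
      · exact Or.inr (Or.inr (eq_neg_of_add_eq_zero_left h))
  classical
  set P := Finset.univ.filter fun i => hA.eigenvalues i = c
  set N := Finset.univ.filter fun i => hA.eigenvalues i = -c
  set Z := Finset.univ.filter fun i => hA.eigenvalues i = 0
  have hcn : c ≠ -c := by linarith
  -- Sums over all eigenvalues are read off from the three multiplicities.
  have split : ∀ {M : Type} [CommMonoid M] (f : ℝ → M),
      ∏ i, f (hA.eigenvalues i) = f 0 ^ Z.card * f c ^ P.card * f (-c) ^ N.card := by
    intro M _ f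
    have hfi : ∀ i, f (hA.eigenvalues i) = (if hA.eigenvalues i = 0 then f 0 else 1) *
        (if hA.eigenvalues i = c then f c else 1) *
        (if hA.eigenvalues i = -c then f (-c) else 1) := by
      intro i
      rcases hev i with h | h | h <;>
        simp [h, hc.ne', hc.ne, hcn, hcn.symm]
    simp_rw [hfi, Finset.prod_mul_distrib, Finset.prod_ite, Finset.prod_const, one_pow, mul_one]
    rfl
  have hsum : ∀ f : ℝ → ℝ, ∑ i, f (hA.eigenvalues i) =
      Z.card * f 0 + P.card * f c + N.card * f (-c) := by
    intro f
    have := split (M := Multiplicative ℝ) (fun x => Multiplicative.ofAdd (f x))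
    have := congrArg Multiplicative.toAdd this
    simpa [toAdd_prod, nsmul_eq_mul] using this
  have htot : Z.card + P.card + N.card = Fintype.card ι := by
    have := hsum (fun _ => 1)
    simp only [Finset.sum_const, Finset.card_univ, nsmul_eq_mul, mul_one] at this
    exact_mod_cast this.symm
  have hT1 : (P.card : ℝ) - N.card = t := by
    have h1 := hA.trace_eq_sum_eigenvalues
    have h2 := hsum id
    simp only [id] at h2
    rw [htr] at h1
    simp only [RCLike.ofReal_real_eq_id, id] at h1
    rw [h2] at h1
    have : c * ((P.card : ℝ) - N.card) = c * t := by linear_combination -h1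
    exact mul_left_cancel₀ hc.ne' this
  have hT2 : (P.card : ℝ) + N.card = 2 * b + t := by
    have h1 : (A * A).trace = ∑ i, hA.eigenvalues i ^ 2 := by
      set φ := Unitary.conjStarAlgAut ℝ (Matrix ι ι ℝ) (star hA.eigenvectorUnitary)
      have hφ : ∀ M, (φ M).trace = M.trace := by
        intro M
        rw [Unitary.conjStarAlgAut_star_apply, Matrix.trace_mul_cycle,
          Unitary.mul_star_self_of_mem hA.eigenvectorUnitary.2, one_mul]
      rw [← hφ (A * A), map_mul, hA.conjStarAlgAut_star_eigenvectorUnitary,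
        Matrix.diagonal_mul_diagonal, Matrix.trace_diagonal]
      simp [sq]
    rw [hsum (fun x => x ^ 2), htr2] at h1
    have : c ^ 2 * ((P.card : ℝ) + N.card) = c ^ 2 * (2 * b + t) := by linear_combination -h1
    exact mul_left_cancel₀ (by positivity) this
  have hNb : N.card = b := by
    have : (N.card : ℝ) = b := by linarith
    exact_mod_cast this
  have hPb : P.card = b + t := by
    have : (P.card : ℝ) = b + t := by linarith
    exact_mod_cast this
  have hZb : Z.card = Fintype.card ι - (2 * b + t) := by omega
  rw [hA.charpoly_eq]
  have := split (fun x => (X - C x : ℝ[X]))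
  simp only [RCLike.ofReal_real_eq_id, id]
  rw [this, hNb, hPb, hZb]
  have hfac : (X ^ 2 - C (c ^ 2) : ℝ[X]) = (X - C c) * (X - C (-c)) := by
    simp only [C_pow, C_neg]; ring
  rw [hfac, mul_pow, pow_add, C_0, sub_zero]
  ring

/-! ### Levels in a finite chain ring -/

/-- A finite local ring `R` of order `q ^ n` with residue field of order `q` whose Jacobson radical
satisfies `J ^ (n - 1) ≠ 0`. These are the finite chain rings of length `n`: the powers of `J` form
a strictly decreasing chain of principal ideals. -/
structure IsFiniteChainRing (R : Type*) [CommRing R] [IsLocalRing R] (q n : ℕ) : Prop where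
  card_eq : Nat.card R = q ^ n
  card_residue : Nat.card (R ⧸ Ring.jacobson R) = q
  pow_ne_bot : Ring.jacobson R ^ (n - 1) ≠ ⊥

namespace IsFiniteChainRing

/-- Every `x` outside `J ^ (k + 1)` has a level `i ≤ k`: it lies in `J ^ i` but not in `J ^ (i + 1)`. -/
theorem exists_level {R : Type*} [CommRing R] {k : ℕ} {x : R} (hx : x ∉ Ring.jacobson R ^ (k + 1)) :
    ∃ i ≤ k, x ∈ Ring.jacobson R ^ i ∧ x ∉ Ring.jacobson R ^ (i + 1) := by
  classical
  have hex : ∃ j, x ∉ Ring.jacobson R ^ (j + 1) := ⟨k, hx⟩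
  refine ⟨Nat.find hex, Nat.find_min' hex hx, ?_, Nat.find_spec hex⟩
  rcases hj : Nat.find hex with _ | j
  · simp
  · exact not_not.1 (Nat.find_min hex (m := j) (by omega))

section Local

variable {R : Type*} [CommRing R] [IsLocalRing R]

theorem isUnit_of_notMem {x : R} (hx : x ∉ Ring.jacobson R) : IsUnit x := by
  rw [IsLocalRing.ringJacobson_eq_maximalIdeal, IsLocalRing.mem_maximalIdeal, mem_nonunits_iff,
    not_not] at hx
  exact hx

theorem jacobson_le_jacobson_bot : Ring.jacobson R ≤ (⊥ : Ideal R).jacobson := by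
  rw [IsLocalRing.ringJacobson_eq_maximalIdeal]
  exact (IsLocalRing.jacobson_eq_maximalIdeal _ bot_ne_top).ge

theorem one_notMem : (1 : R) ∉ Ring.jacobson R := by
  rw [IsLocalRing.ringJacobson_eq_maximalIdeal]
  simp

end Local

section Chain

variable {R : Type*} [CommRing R] [Finite R] [IsLocalRing R] {q n : ℕ}

/-- The sums `a + r * x`, with `a ∈ J ^ (i + 1)` and `r` running through representatives of the
residue field, are pairwise distinct. -/
theorem card_mul_le_card_span_sup {i : ℕ} {x : R} (hx' : x ∉ Ring.jacobson R ^ (i + 1)) :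
    Nat.card (R ⧸ Ring.jacobson R) * Nat.card ↥(Ring.jacobson R ^ (i + 1)) ≤
      Nat.card ↥(Ideal.span {x} ⊔ Ring.jacobson R ^ (i + 1)) := by
  rw [← Nat.card_prod]
  refine Nat.card_le_card_of_injective (fun p => ⟨p.1.out * x + p.2, Submodule.add_mem_sup
    (Ideal.mul_mem_left _ _ (Ideal.mem_span_singleton_self x)) p.2.2⟩) ?_
  rintro ⟨r, a, ha⟩ ⟨s, b, hb⟩ h
  have h1 : r.out * x + a = s.out * x + b := congrArg Subtype.val h
  have hrs : r = s := by
    by_contra hne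
    have hnm : r.out - s.out ∉ Ring.jacobson R := fun hm => hne <| by
      rw [← Ideal.Quotient.mk_out r, ← Ideal.Quotient.mk_out s]
      exact Ideal.Quotient.eq.2 hm
    refine hx' ((Ideal.unit_mul_mem_iff_mem _ (isUnit_of_notMem hnm)).1 ?_)
    have : (r.out - s.out) * x = b - a := by linear_combination h1
    rw [this]
    exact Ideal.sub_mem _ hb ha
  subst hrs
  simpa using h1

variable (h : IsFiniteChainRing R q n)
include h

theorem one_lt_q : 1 < q := by
  have := IsLocalRing.ringJacobson_eq_maximalIdeal R
  have : Nontrivial (R ⧸ Ring.jacobson R) := Ideal.Quotient.nontrivial_iff.2 <| by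
    rw [this]; exact IsLocalRing.maximalIdeal.isMaximal R |>.ne_top
  have : Finite (R ⧸ Ring.jacobson R) := Quotient.finite _
  rw [← h.card_residue]
  exact Finite.one_lt_card

theorem n_pos : 0 < n := by
  rcases Nat.eq_zero_or_pos n with rfl | hn
  · have := h.card_eq
    have h1 : 1 < Nat.card R := Finite.one_lt_card
    simp_all
  · exact hn

theorem exists_mem_notMem {i : ℕ} (hi : i < n) :
    ∃ x ∈ Ring.jacobson R ^ i, x ∉ Ring.jacobson R ^ (i + 1) := by
  by_contra! hc
  have : Ring.jacobson R ^ i = ⊥ := by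
    refine Submodule.eq_bot_of_le_smul_of_le_jacobson_bot (Ring.jacobson R) _
      (IsNoetherian.noetherian _) ?_ jacobson_le_jacobson_bot
    intro x hx
    simpa [smul_eq_mul, ← pow_succ'] using hc x hx
  refine h.pow_ne_bot (le_bot_iff.1 (this ▸ Ideal.pow_le_pow_right (by omega)))

theorem mul_card_pow_succ_le {i : ℕ} (hi : i < n) :
    q * Nat.card ↥(Ring.jacobson R ^ (i + 1)) ≤ Nat.card ↥(Ring.jacobson R ^ i) := by
  obtain ⟨x, hx, hx'⟩ := h.exists_mem_notMem hi
  rw [← h.card_residue]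
  refine (card_mul_le_card_span_sup hx').trans (Nat.card_mono (Set.toFinite _) ?_)
  exact sup_le ((Ideal.span_singleton_le_iff_mem _).2 hx) (Ideal.pow_le_pow_right (by omega))

/-- The quotients of consecutive powers of `J` have order at least `q`, and the order of `R` forces
equality throughout. -/
theorem card_pow {i : ℕ} (hi : i ≤ n) : Nat.card ↥(Ring.jacobson R ^ i) = q ^ (n - i) := by
  have hq := h.one_lt_q
  have upper : ∀ j, j ≤ n → q ^ j * Nat.card ↥(Ring.jacobson R ^ j) ≤ q ^ n := by
    intro j
    induction j with
    | zero =>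
      intro _
      rw [← h.card_eq]
      simp
    | succ j ih =>
      intro hj
      calc _ = q ^ j * (q * Nat.card ↥(Ring.jacobson R ^ (j + 1))) := by ring
        _ ≤ _ := Nat.mul_le_mul_left _ (h.mul_card_pow_succ_le hj)
        _ ≤ _ := ih (by omega)
  have lower : ∀ j, j ≤ n → q ^ j ≤ Nat.card ↥(Ring.jacobson R ^ (n - j)) := by
    intro j
    induction j with
    | zero => intro _; rw [pow_zero]; exact Nat.card_pos
    | succ j ih =>
      intro hj
      have h1 := h.mul_card_pow_succ_le (i := n - (j + 1)) (by omega)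
      rw [show n - (j + 1) + 1 = n - j by omega] at h1
      exact (pow_succ' q j ▸ Nat.mul_le_mul_left q (ih (by omega))).trans h1
  refine le_antisymm ?_ ?_
  · have := upper i hi
    rw [← Nat.add_sub_cancel' hi, pow_add] at this
    exact Nat.le_of_mul_le_mul_left this (Nat.pow_pos (zero_lt_one.trans h.one_lt_q))
  · simpa [Nat.sub_sub_self hi] using lower (n - i) (by omega)

theorem pow_eq_bot : Ring.jacobson R ^ n = ⊥ := by
  have := h.card_pow le_rfl
  rw [Nat.sub_self, pow_zero, Nat.card_eq_one_iff_unique] at this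
  exact (Submodule.subsingleton_iff_eq_bot).1 this.1

theorem lt_of_notMem {k : ℕ} {u : R} (hu' : u ∉ Ring.jacobson R ^ (k + 1))
    (hu : u ∈ Ring.jacobson R ^ k) : k < n := by
  by_contra! hk
  have := Ideal.pow_le_pow_right (I := Ring.jacobson R) hk hu
  rw [h.pow_eq_bot, Ideal.mem_bot] at this
  exact hu' (this ▸ zero_mem _)

/-- An element of `J ^ i` outside `J ^ (i + 1)` generates `J ^ i`. -/
theorem span_eq {i : ℕ} {x : R} (hx : x ∈ Ring.jacobson R ^ i)
    (hx' : x ∉ Ring.jacobson R ^ (i + 1)) : Ideal.span {x} = Ring.jacobson R ^ i := by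
  have hi := h.lt_of_notMem hx' hx
  refine le_antisymm ((Ideal.span_singleton_le_iff_mem _).2 hx) ?_
  refine Submodule.le_of_le_smul_of_le_jacobson_bot (I := Ring.jacobson R)
    (IsNoetherian.noetherian _) jacobson_le_jacobson_bot ?_
  rw [smul_eq_mul, ← pow_succ']
  have hle : Ideal.span {x} ⊔ Ring.jacobson R ^ (i + 1) ≤ Ring.jacobson R ^ i :=
    sup_le ((Ideal.span_singleton_le_iff_mem _).2 hx) (Ideal.pow_le_pow_right (by omega))
  have hcard := card_mul_le_card_span_sup hx'
  rw [h.card_residue, h.card_pow (show i + 1 ≤ n by omega), ← pow_succ',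
    show n - (i + 1) + 1 = n - i by omega, ← h.card_pow hi.le] at hcard
  exact (SetLike.coe_injective (Set.eq_of_subset_of_ncard_le hle (by
      rwa [← Nat.card_coe_set_eq, ← Nat.card_coe_set_eq])
    (Set.toFinite _))).ge

theorem pow_ne_pow_succ {i : ℕ} (hi : i < n) :
    ¬ Ring.jacobson R ^ i ≤ Ring.jacobson R ^ (i + 1) := by
  obtain ⟨x, hx, hx'⟩ := h.exists_mem_notMem hi
  exact fun hle => hx' (hle hx)

/-- The annihilator of an element generating `J ^ i`. -/
theorem mul_eq_zero_iff {i : ℕ} {x : R} (hx : x ∈ Ring.jacobson R ^ i)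
    (hx' : x ∉ Ring.jacobson R ^ (i + 1)) (y : R) :
    x * y = 0 ↔ y ∈ Ring.jacobson R ^ (n - i) := by
  have hi := h.lt_of_notMem hx' hx
  set K : Ideal R := LinearMap.ker (LinearMap.mulLeft R x) with hK
  have hle : Ring.jacobson R ^ (n - i) ≤ K := by
    intro z hz
    rw [hK, LinearMap.mem_ker, LinearMap.mulLeft_apply, ← Ideal.mem_bot, ← h.pow_eq_bot]
    have := Ideal.mul_mem_mul hx hz
    rwa [← pow_add, Nat.add_sub_cancel' hi.le] at this
  have hrange : LinearMap.range (LinearMap.mulLeft R x) = Ring.jacobson R ^ i := by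
    rw [← h.span_eq hx hx']
    ext z
    simp [Ideal.mem_span_singleton', mul_comm]
  have hcard : Nat.card K ≤ Nat.card ↥(Ring.jacobson R ^ (n - i)) := by
    have h1 := Submodule.card_eq_card_quotient_mul_card K
    rw [Nat.card_congr (LinearMap.mulLeft R x).quotKerEquivRange.toEquiv, hrange,
      h.card_pow hi.le, h.card_eq] at h1
    rw [h.card_pow (by omega)]
    have hq := h.one_lt_q
    refine le_of_mul_le_mul_left ?_ (Nat.pow_pos (zero_lt_one.trans hq) : 0 < q ^ (n - i))
    rw [← pow_add, show n - i + (n - (n - i)) = n by omega, h1, mul_comm]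
  have : Ring.jacobson R ^ (n - i) = K := SetLike.coe_injective
    (Set.eq_of_subset_of_ncard_le hle (by
      rwa [← Nat.card_coe_set_eq, ← Nat.card_coe_set_eq]) (Set.toFinite _))
  rw [this, hK, LinearMap.mem_ker, LinearMap.mulLeft_apply]

/-- Levels add up in products. -/
theorem level_right {i k : ℕ} {x y u : R} (hu : u ∈ Ring.jacobson R ^ k)
    (hu' : u ∉ Ring.jacobson R ^ (k + 1)) (hx : x ∈ Ring.jacobson R ^ i)
    (hx' : x ∉ Ring.jacobson R ^ (i + 1)) (hxy : x * y = u) :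
    i ≤ k ∧ y ∈ Ring.jacobson R ^ (k - i) ∧ y ∉ Ring.jacobson R ^ (k - i + 1) := by
  have hy : y ∉ Ring.jacobson R ^ (k + 1) := fun hy => hu' (hxy ▸ Ideal.mul_mem_left _ x hy)
  obtain ⟨j, -, hj, hj'⟩ := exists_level hy
  have hk := h.lt_of_notMem hu' hu
  have hpow : Ring.jacobson R ^ (i + j) = Ring.jacobson R ^ k := by
    rw [pow_add, ← h.span_eq hx hx', ← h.span_eq hj hj', ← h.span_eq hu hu',
      Ideal.span_singleton_mul_span_singleton, hxy]
  have hij : i + j = k := by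
    rcases lt_trichotomy (i + j) k with hlt | heq | hgt
    · exact absurd (hpow.le.trans (Ideal.pow_le_pow_right hlt))
        (h.pow_ne_pow_succ (by omega))
    · exact heq
    · exact absurd (hpow.ge.trans (Ideal.pow_le_pow_right hgt)) (h.pow_ne_pow_succ hk)
  obtain rfl : j = k - i := by omega
  exact ⟨by omega, hj, hj'⟩

end Chain

/-! ### Solutions of `x * y = u` and square roots -/

theorem ncard_coset {R : Type*} [CommRing R] (I : Ideal R) (z : R) :
    {y : R | y - z ∈ I}.ncard = Nat.card I := by
  rw [← Nat.card_coe_set_eq]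
  exact Nat.card_congr ⟨fun y => ⟨y.1 - z, y.2⟩, fun a => ⟨a.1 + z, by simp⟩,
    fun y => by simp, fun a => by simp⟩

section Finite

variable {R : Type*} [CommRing R] [Finite R] [IsLocalRing R] {q n : ℕ}

variable (h : IsFiniteChainRing R q n)
include h

/-- The solutions of `x * y = u` form a coset of the annihilator of `x`. -/
theorem mul_eq_iff {i : ℕ} {x z u : R} (hx : x ∈ Ring.jacobson R ^ i)
    (hx' : x ∉ Ring.jacobson R ^ (i + 1)) (hz : x * z = u) (y : R) :
    x * y = u ↔ y - z ∈ Ring.jacobson R ^ (n - i) := by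
  rw [← h.mul_eq_zero_iff hx hx', mul_sub, hz, sub_eq_zero]

theorem ncard_mul_eq {i k : ℕ} {x u : R} (hu : u ∈ Ring.jacobson R ^ k)
    (hx : x ∈ Ring.jacobson R ^ i) (hx' : x ∉ Ring.jacobson R ^ (i + 1)) (hik : i ≤ k) :
    {y | x * y = u}.ncard = q ^ i := by
  have hi := h.lt_of_notMem hx' hx
  have hmem : u ∈ Ideal.span {x} := h.span_eq hx hx' ▸ Ideal.pow_le_pow_right hik hu
  obtain ⟨z, hz⟩ := Ideal.mem_span_singleton'.1 hmem
  simp_rw [h.mul_eq_iff hx hx' (mul_comm z x ▸ hz), ncard_coset]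
  rw [h.card_pow (by omega), Nat.sub_sub_self hi.le]

/-- The number of elements of level `i`. -/
theorem ncard_level {i : ℕ} (hi : i < n) :
    {x : R | x ∈ Ring.jacobson R ^ i ∧ x ∉ Ring.jacobson R ^ (i + 1)}.ncard =
      q ^ (n - i - 1) * (q - 1) := by
  have hle : ((Ring.jacobson R ^ (i + 1) : Ideal R) : Set R) ⊆ (Ring.jacobson R ^ i : Ideal R) :=
    Ideal.pow_le_pow_right (by omega)
  have := Set.ncard_sdiff hle (Set.toFinite _)
  refine Eq.trans this ?_
  have h1 := h.card_pow hi.le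
  have h2 := h.card_pow (show i + 1 ≤ n by omega)
  rw [← Nat.card_coe_set_eq, ← Nat.card_coe_set_eq]
  refine (congrArg₂ (· - ·) h1 h2).trans ?_
  obtain ⟨m, rfl⟩ : ∃ m, n = i + 1 + m := ⟨n - (i + 1), by omega⟩
  rw [show i + 1 + m - i = m + 1 by omega, show i + 1 + m - (i + 1) = m by omega,
    Nat.add_sub_cancel, Nat.mul_sub, pow_succ, mul_one]

/-- If `x * y = y * z = z * w = u`, then `x` and `z` have the same level, as do `y` and `w`; hence
`x - z` annihilates `w` along with `y`, and `x * w = u`. -/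
theorem mul_eq_of_path {k : ℕ} {u : R} (hu : u ∈ Ring.jacobson R ^ k)
    (hu' : u ∉ Ring.jacobson R ^ (k + 1)) {x y z w : R} (h1 : x * y = u) (h2 : y * z = u)
    (h3 : z * w = u) : x * w = u := by
  have hy : y ∉ Ring.jacobson R ^ (k + 1) := fun hy => hu' (h1 ▸ Ideal.mul_mem_left _ x hy)
  obtain ⟨j, hjk, hj, hj'⟩ := exists_level hy
  obtain ⟨-, hz, hz'⟩ := h.level_right hu hu' hj hj' h2
  obtain ⟨-, hw, hw'⟩ := h.level_right hu hu' hz hz' h3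
  rw [Nat.sub_sub_self hjk] at hw hw'
  have h4 : w * z = u := by rw [mul_comm, h3]
  have h5 : y * x = u := by rw [mul_comm, h1]
  rw [mul_comm x, h.mul_eq_iff hw hw' h4, ← h.mul_eq_iff hj hj' h2, h5]

theorem ncard_paths {k : ℕ} {u : R} (hu : u ∈ Ring.jacobson R ^ k)
    (hu' : u ∉ Ring.jacobson R ^ (k + 1)) {x w : R} (hxw : x * w = u) :
    {p : R × R | x * p.1 = u ∧ p.1 * p.2 = u ∧ p.2 * w = u}.ncard = q ^ k := by
  have hx : x ∉ Ring.jacobson R ^ (k + 1) := fun hx => hu' (hxw ▸ Ideal.mul_mem_right w _ hx)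
  obtain ⟨i, hik, hi, hi'⟩ := exists_level hx
  obtain ⟨-, hw, hw'⟩ := h.level_right hu hu' hi hi' hxw
  have hset : {p : R × R | x * p.1 = u ∧ p.1 * p.2 = u ∧ p.2 * w = u} =
      {y | x * y = u} ×ˢ {z | w * z = u} := by
    ext ⟨y, z⟩
    simp only [Set.mem_ofPred_eq, Set.mem_prod, mul_comm w z]
    refine ⟨fun ⟨h1, _, h3⟩ => ⟨h1, h3⟩, fun ⟨h1, h3⟩ => ⟨h1, ?_, h3⟩⟩
    rw [mul_comm]
    exact h.mul_eq_of_path hu hu' h3 (mul_comm w x ▸ hxw) h1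
  rw [hset, Set.ncard_prod, h.ncard_mul_eq hu hi hi' hik,
    h.ncard_mul_eq hu hw hw' (Nat.sub_le _ _), ← pow_add, Nat.add_sub_cancel' hik]

/-- A square root has half the level. -/
theorem level_of_sq_eq {k : ℕ} {u s : R} (hu : u ∈ Ring.jacobson R ^ k)
    (hu' : u ∉ Ring.jacobson R ^ (k + 1)) (hs : s ^ 2 = u) :
    ∃ i, k = 2 * i ∧ s ∈ Ring.jacobson R ^ i ∧ s ∉ Ring.jacobson R ^ (i + 1) := by
  have hs' : s ∉ Ring.jacobson R ^ (k + 1) := fun hm =>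
    hu' (hs ▸ Ideal.pow_mem_of_mem _ hm 2 (by norm_num))
  obtain ⟨i, hik, hi, hi'⟩ := exists_level hs'
  obtain ⟨-, hj, hj'⟩ := h.level_right hu hu' hi hi' (sq s ▸ hs)
  refine ⟨i, ?_, hi, hi'⟩
  rcases lt_trichotomy (k - i) i with hlt | heq | hgt
  · exact absurd (Ideal.pow_le_pow_right hlt hi) hj'
  · omega
  · exact absurd (Ideal.pow_le_pow_right hgt hj) hi'

theorem isUnit_two (hq : Odd q) : IsUnit (2 : R) := by
  have : Finite (R ⧸ Ring.jacobson R) := Quotient.finite _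
  refine isUnit_of_notMem fun h2 => ?_
  have h2' : (2 : R ⧸ Ring.jacobson R) = 0 := by
    rw [← map_ofNat (Ideal.Quotient.mk (Ring.jacobson R)) 2]
    exact Ideal.Quotient.eq_zero_iff_mem.2 h2
  -- If `2 = 0` in the residue field, then `q` is zero and odd in it.
  have hq0 : ((q : ℕ) : R ⧸ Ring.jacobson R) = 0 := by
    rw [← h.card_residue]
    have := card_nsmul_eq_zero' (x := (1 : R ⧸ Ring.jacobson R))
    simpa using this
  obtain ⟨m, hm⟩ := hq
  rw [hm] at hq0
  push_cast at hq0
  rw [h2', zero_mul, zero_add] at hq0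
  exact one_notMem (R := R) (Ideal.Quotient.eq_zero_iff_mem.1 (by simpa using hq0))

/-- For odd `q`, the square roots of `s ^ 2` are the two cosets of `J ^ (n - i)` through `s` and
`-s`, where `i` is the level of `s`. -/
theorem ncard_sq_eq {i : ℕ} (hq : Odd q) (hin : 2 * i < n) {s : R} (hi : s ∈ Ring.jacobson R ^ i)
    (hi' : s ∉ Ring.jacobson R ^ (i + 1)) : {x : R | x ^ 2 = s ^ 2}.ncard = 2 * q ^ i := by
  have h2 := h.isUnit_two hq
  have h2s : 2 * s ∉ Ring.jacobson R ^ (i + 1) := fun hm =>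
    hi' ((Ideal.unit_mul_mem_iff_mem _ h2).1 hm)
  have hle : Ring.jacobson R ^ (n - i) ≤ Ring.jacobson R ^ (i + 1) :=
    Ideal.pow_le_pow_right (by omega)
  have hprod : ∀ a ∈ Ring.jacobson R ^ (n - i), ∀ b ∈ Ring.jacobson R ^ i, a * b = 0 := by
    intro a ha b hb
    have := Ideal.mul_mem_mul ha hb
    rwa [← pow_add, Nat.sub_add_cancel (by omega), h.pow_eq_bot, Ideal.mem_bot] at this
  have hset : {x : R | x ^ 2 = s ^ 2} = {x | x - s ∈ Ring.jacobson R ^ (n - i)} ∪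
      {x | x - -s ∈ Ring.jacobson R ^ (n - i)} := by
    ext x
    simp only [Set.mem_ofPred_eq, Set.mem_union]
    constructor
    · intro hx
      have hsq : s ^ 2 ∈ Ring.jacobson R ^ (2 * i) := by
        rw [two_mul, pow_add, sq]; exact Ideal.mul_mem_mul hi hi
      have hx0 : (x + s) * (x - s) = 0 := by linear_combination hx
      -- If `x` had a level `j < i`, then `x ^ 2` would have level `2 * j < 2 * i`.
      have hxi : x ∈ Ring.jacobson R ^ i := by
        by_contra hxi
        rcases i with _ | i
        · simp at hxi
        · obtain ⟨j, hji, hj, hj'⟩ := exists_level hxi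
          have hsq' : s ^ 2 ∉ Ring.jacobson R ^ (2 * j + 1) := by
            intro hm
            have hspan := h.span_eq hj hj'
            have hmem : x ^ 2 ∈ Ring.jacobson R ^ (2 * j + 1) := hx ▸ hm
            refine h.pow_ne_pow_succ (i := 2 * j) (by omega) ?_
            rw [two_mul, pow_add, ← hspan, Ideal.span_singleton_mul_span_singleton, ← two_mul,
              Ideal.span_singleton_le_iff_mem, ← sq]
            exact hmem
          exact hsq' (Ideal.pow_le_pow_right (by omega) hsq)
      have hadd : x + s ∈ Ring.jacobson R ^ i := Ideal.add_mem _ hxi hi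
      have hsub : x - s ∈ Ring.jacobson R ^ i := Ideal.sub_mem _ hxi hi
      -- The difference `2 * s` of the two factors has level `i`, so one of the factors does too, and
      -- the other one lies in its annihilator.
      by_cases hadd' : x + s ∈ Ring.jacobson R ^ (i + 1)
      · have hsub' : x - s ∉ Ring.jacobson R ^ (i + 1) := fun hm => h2s <| by
          have := Ideal.sub_mem _ hadd' hm
          rwa [show x + s - (x - s) = 2 * s by ring] at this
        right
        rw [sub_neg_eq_add, ← h.mul_eq_zero_iff hsub hsub', mul_comm, hx0]
      · left
        rw [← h.mul_eq_zero_iff hadd hadd', hx0]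
    · have hmi : ∀ a ∈ Ring.jacobson R ^ (n - i), a ∈ Ring.jacobson R ^ i :=
        fun a ha => Ideal.pow_le_pow_right (by omega) ha
      rintro (hx | hx)
      · have := hprod _ hx (x + s) (by
          have := Ideal.add_mem _ (hmi _ hx) (Ideal.mul_mem_left _ 2 hi)
          rwa [show x - s + 2 * s = x + s by ring] at this)
        linear_combination this
      · have := hprod _ hx (x - s) (by
          have := Ideal.sub_mem _ (hmi _ hx) (Ideal.mul_mem_left _ 2 hi)
          rwa [show x - -s - 2 * s = x - s by ring] at this)
        linear_combination this
  have hdisj : Disjoint {x | x - s ∈ Ring.jacobson R ^ (n - i)}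
      {x | x - -s ∈ Ring.jacobson R ^ (n - i)} := by
    rw [Set.disjoint_left]
    intro x hx hx'
    have := hle (Ideal.sub_mem _ hx' hx)
    rw [show x - -s - (x - s) = 2 * s by ring] at this
    exact h2s this
  rw [hset, Set.ncard_union_eq hdisj, ncard_coset, ncard_coset, h.card_pow (by omega),
    Nat.sub_sub_self (by omega), two_mul]

/-- Squaring maps the elements of level `i` onto the squares of level `2 * i`, and each fibre has
`2 * q ^ i` elements. -/
theorem ncard_squares {i : ℕ} (hq : Odd q) (hin : 2 * i < n) :
    {v : R | v ∈ Ring.jacobson R ^ (2 * i) ∧ v ∉ Ring.jacobson R ^ (2 * i + 1) ∧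
      ∃ s : R, v = s ^ 2}.ncard = q ^ (n - 2 * i - 1) * (q - 1) / 2 := by
  classical
  have := Fintype.ofFinite R
  have hq1 := h.one_lt_q
  set L := {x : R | x ∈ Ring.jacobson R ^ i ∧ x ∉ Ring.jacobson R ^ (i + 1)}
  set S := {v : R | v ∈ Ring.jacobson R ^ (2 * i) ∧ v ∉ Ring.jacobson R ^ (2 * i + 1) ∧
      ∃ s : R, v = s ^ 2}
  have hmaps : ∀ s ∈ L.toFinset, s ^ 2 ∈ S.toFinset := by
    intro s hs
    rw [Set.mem_toFinset] at hs ⊢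
    obtain ⟨hs, hs'⟩ := hs
    refine ⟨?_, fun hm => ?_, s, rfl⟩
    · rw [two_mul, pow_add, sq]; exact Ideal.mul_mem_mul hs hs
    · refine h.pow_ne_pow_succ hin ?_
      rw [two_mul, pow_add, ← h.span_eq hs hs', Ideal.span_singleton_mul_span_singleton, ← two_mul,
        Ideal.span_singleton_le_iff_mem, ← sq]
      exact hm
  have hfib : ∀ v ∈ S.toFinset, (L.toFinset.filter fun s => s ^ 2 = v).card = 2 * q ^ i := by
    intro v hv
    rw [Set.mem_toFinset] at hv
    obtain ⟨hv, hv', t, rfl⟩ := hv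
    have key : ∀ s : R, s ^ 2 = t ^ 2 → s ∈ L := by
      intro s hs
      obtain ⟨j, hj, hsj⟩ := h.level_of_sq_eq hv hv' hs
      obtain rfl : i = j := by omega
      exact hsj
    rw [← h.ncard_sq_eq hq hin (key t rfl).1 (key t rfl).2, Set.ncard_eq_toFinset_card']
    congr 1
    ext s
    simp only [Finset.mem_filter, Set.mem_toFinset, Set.mem_ofPred_eq]
    exact ⟨fun hs => hs.2, fun hs => ⟨key s hs, hs⟩⟩
  have hcard := Finset.card_eq_sum_card_fiberwise hmaps
  rw [Finset.sum_congr rfl hfib, Finset.sum_const, ← Set.ncard_eq_toFinset_card',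
    ← Set.ncard_eq_toFinset_card', h.ncard_level (by omega), smul_eq_mul,
    show n - i - 1 = i + (n - 2 * i - 1) by omega, pow_add] at hcard
  refine (Nat.div_eq_of_eq_mul_left two_pos ?_).symm
  refine Nat.eq_of_mul_eq_mul_left (Nat.pow_pos (n := i) (show 0 < q by omega)) ?_
  linear_combination hcard

end Finite

/-! ### The spectrum of the product matrix -/

section ProductMatrix

theorem trace_productMatrix {R : Type*} [CommRing R] [Fintype R] [DecidableEq R] (u : R) :
    (productMatrix R u).trace = ({x : R | x ^ 2 = u}.ncard : ℝ) := by
  rw [Set.ncard_eq_toFinset_card']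
  simp [productMatrix, Matrix.trace, sq]

variable {R : Type*} [CommRing R] [Fintype R] [DecidableEq R] [IsLocalRing R] {q n : ℕ}
  (h : IsFiniteChainRing R q n) {k : ℕ} {u : R} (hu : u ∈ Ring.jacobson R ^ k)
  (hu' : u ∉ Ring.jacobson R ^ (k + 1))
include h hu hu'

theorem productMatrix_cube :
    productMatrix R u * productMatrix R u * productMatrix R u =
      (q : ℝ) ^ k • productMatrix R u := by
  ext x w
  rw [mul_assoc, Matrix.mul_apply]
  simp_rw [Matrix.mul_apply, Finset.mul_sum, Matrix.smul_apply, productMatrix, Matrix.of_apply]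
  rw [← Finset.sum_product']
  have hterm : ∀ p : R × R, ((if x * p.1 = u then 1 else 0) *
      ((if p.1 * p.2 = u then 1 else 0) * (if p.2 * w = u then 1 else 0)) : ℝ) =
      if x * p.1 = u ∧ p.1 * p.2 = u ∧ p.2 * w = u then 1 else 0 := by
    intro p
    by_cases h1 : x * p.1 = u <;> by_cases h2 : p.1 * p.2 = u <;> simp [h1, h2]
  rw [Finset.sum_congr rfl fun p _ => hterm p, Finset.univ_product_univ, Finset.sum_boole]
  by_cases hxw : x * w = u
  · rw [if_pos hxw, ← Nat.cast_pow, ← h.ncard_paths hu hu' hxw, Set.ncard_eq_toFinset_card']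
    simp
  · rw [if_neg hxw, Finset.filter_eq_empty_iff.2]
    · simp
    · exact fun p _ ⟨h1, h2, h3⟩ => hxw (h.mul_eq_of_path hu hu' h1 h2 h3)

omit [DecidableEq R] in
theorem sum_ncard_mul_eq :
    ∑ x : R, {y | x * y = u}.ncard = (k + 1) * (q ^ (n - 1) * (q - 1)) := by
  have hk := h.lt_of_notMem hu' hu
  -- An `x` in `J ^ (k + 1)` divides no element outside `J ^ (k + 1)`; level `i` contributes `q ^ i`
  -- solutions for each of its elements.
  have hsum : ∀ x : R, {y | x * y = u}.ncard = ∑ i ∈ Finset.range (k + 1),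
      Set.indicator {x : R | x ∈ Ring.jacobson R ^ i ∧ x ∉ Ring.jacobson R ^ (i + 1)}
        (fun _ => q ^ i) x := by
    intro x
    by_cases hx : x ∈ Ring.jacobson R ^ (k + 1)
    · rw [Finset.sum_eq_zero, Set.ncard_eq_zero]
      · exact Set.eq_empty_of_forall_notMem
          fun y hy => hu' (by rw [← Set.mem_ofPred.1 hy]; exact Ideal.mul_mem_right y _ hx)
      · intro i hi
        refine Set.indicator_of_notMem (fun hxi => hxi.2 ?_) _
        exact Ideal.pow_le_pow_right (by simpa using hi) hx
    · obtain ⟨i, hik, hi, hi'⟩ := exists_level hx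
      rw [h.ncard_mul_eq hu hi hi' hik, Finset.sum_eq_single_of_mem i (by simpa using by omega)]
      · exact (Set.indicator_of_mem
          (s := {x : R | x ∈ Ring.jacobson R ^ i ∧ x ∉ Ring.jacobson R ^ (i + 1)}) ⟨hi, hi'⟩
          (fun _ => q ^ i)).symm
      · intro j _ hji
        refine Set.indicator_of_notMem (fun hxj => ?_) _
        rcases lt_or_gt_of_ne hji with hlt | hgt
        · exact hxj.2 (Ideal.pow_le_pow_right hlt hi)
        · exact hi' (Ideal.pow_le_pow_right hgt hxj.1)
  simp_rw [hsum]
  rw [Finset.sum_comm]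
  have hlevel : ∀ i ∈ Finset.range (k + 1), ∑ x : R,
      Set.indicator {x : R | x ∈ Ring.jacobson R ^ i ∧ x ∉ Ring.jacobson R ^ (i + 1)}
        (fun _ => q ^ i) x = q ^ (n - 1) * (q - 1) := by
    intro i hi
    have hik : i ≤ k := by simpa [Nat.lt_succ_iff] using hi
    classical
    simp_rw [Set.indicator_apply, ← Finset.sum_filter, Finset.sum_const, smul_eq_mul]
    have := h.ncard_level (show i < n by omega)
    rw [Set.ncard_eq_toFinset_card', Set.toFinset_ofPred] at this
    simp only [Set.mem_ofPred_eq]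
    rw [this, mul_right_comm, ← pow_add, show n - i - 1 + i = n - 1 by omega]
  rw [Finset.sum_congr rfl hlevel, Finset.sum_const, Finset.card_range, smul_eq_mul]

theorem trace_productMatrix_sq : (productMatrix R u * productMatrix R u).trace =
    (q : ℝ) ^ k * ((q ^ (n - k - 1) * (q - 1) * (k + 1) : ℕ) : ℝ) := by
  have hk := h.lt_of_notMem hu' hu
  have h1 := h.sum_ncard_mul_eq hu hu'
  have h2 : q ^ k * (q ^ (n - k - 1) * (q - 1) * (k + 1)) =
      (k + 1) * (q ^ (n - 1) * (q - 1)) := by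
    rw [show n - 1 = k + (n - k - 1) by omega, pow_add]; ring
  rw [← Nat.cast_pow, ← Nat.cast_mul, h2, ← h1, Nat.cast_sum, Matrix.trace]
  refine Finset.sum_congr rfl fun x _ => ?_
  rw [Matrix.diag_apply, Matrix.mul_apply, Set.ncard_eq_toFinset_card']
  simp [productMatrix, mul_comm _ x, ← ite_and]

/-- Here `c` is the positive square root of `q ^ k`, and `t` is the trace of `productMatrix R u`
divided by `c`: the number by which the multiplicity of `c` exceeds that of `-c`. -/
theorem detCharpoly_productMatrix {b t : ℕ} {c : ℝ} (hc : 0 < c)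
    (hck : c ^ 2 = (q : ℝ) ^ k) (hroots : ({x : R | x ^ 2 = u}.ncard : ℝ) = c * t)
    (hbt : q ^ (n - k - 1) * (q - 1) * (k + 1) = 2 * b + t) :
    detCharpoly (productMatrix R u) = (-1) ^ q *
      (X ^ (q ^ (n - k - 1) * (q ^ (k + 1) - (k + 1) * (q - 1))) *
        (X ^ 2 - C ((q : ℝ) ^ k)) ^ b * (X - C c) ^ t) := by
  have hk := h.lt_of_notMem hu' hu
  have hherm : (productMatrix R u).IsHermitian := by
    ext x y
    simp [productMatrix, mul_comm]
  have hcard : Fintype.card R = q ^ n := by rw [← Nat.card_eq_fintype_card, h.card_eq]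
  have hsign : ((-1 : ℝ[X]) ^ q ^ n) = (-1) ^ q := by
    have hn := h.n_pos.ne'
    rcases Nat.even_or_odd q with hq | hq
    · rw [hq.neg_one_pow, (hq.pow_of_ne_zero hn).neg_one_pow]
    · rw [hq.neg_one_pow, hq.pow.neg_one_pow]
  rw [detCharpoly_eq, charpoly_eq_of_cube_eq hherm hc
    (hck ▸ h.productMatrix_cube hu hu') (b := b) (t := t) (by rw [trace_productMatrix, hroots])
    (by rw [h.trace_productMatrix_sq hu hu', hbt, hck]; push_cast; ring), hcard, hsign, hck,
    ← hbt, Nat.mul_sub (q ^ (n - k - 1)) (q ^ (k + 1)), ← pow_add,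
    show n - k - 1 + (k + 1) = n by omega,
    show q ^ (n - k - 1) * (q - 1) * (k + 1) = q ^ (n - k - 1) * ((k + 1) * (q - 1)) by ring]

end ProductMatrix

end IsFiniteChainRing

theorem theorem4p6 {R : Type*} [CommRing R] [Fintype R] [DecidableEq R] [IsLocalRing R]
    (q n k : ℕ) (hcard : Nat.card R = q ^ n)
    (hres : Nat.card (R ⧸ Ring.jacobson R) = q)
    (hJ : Ring.jacobson R ^ (n - 1) ≠ ⊥)
    (u : R) (hu : u ∈ Ring.jacobson R ^ k) (hu' : u ∉ Ring.jacobson R ^ (k + 1)) :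
    (Odd k →
      detCharpoly (productMatrix R u) =
        (-1) ^ q * X ^ (q ^ (n - k - 1) * (q ^ (k + 1) - (k + 1) * (q - 1))) *
          (X ^ 2 - C ((q : ℝ) ^ k)) ^ (q ^ (n - k - 1) * (q - 1) * (k + 1) / 2)) ∧
    (Even k → Odd q →
      ((∃ s : R, u = s ^ 2) →
        detCharpoly (productMatrix R u) =
          -(X ^ (q ^ (n - k - 1) * (q ^ (k + 1) - (k + 1) * (q - 1))) *
            (X ^ 2 - C ((q : ℝ) ^ k)) ^ (q ^ (n - k - 1) * (q - 1) * (k + 1) / 2 - 1) *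
            (X - C ((q : ℝ) ^ (k / 2))) ^ 2)) ∧
      ((¬ ∃ s : R, u = s ^ 2) →
        detCharpoly (productMatrix R u) =
          -(X ^ (q ^ (n - k - 1) * (q ^ (k + 1) - (k + 1) * (q - 1))) *
            (X ^ 2 - C ((q : ℝ) ^ k)) ^ (q ^ (n - k - 1) * (q - 1) * (k + 1) / 2))) ∧
      Set.ncard {v : R | v ∈ Ring.jacobson R ^ k ∧ v ∉ Ring.jacobson R ^ (k + 1) ∧
        ∃ s : R, v = s ^ 2} = q ^ (n - k - 1) * (q - 1) / 2) := by
  have h : IsFiniteChainRing R q n := ⟨hcard, hres, hJ⟩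
  have hk := h.lt_of_notMem hu' hu
  have hq := h.one_lt_q
  have hq0 : (0 : ℝ) < q := by exact_mod_cast zero_lt_one.trans hq
  have nonsquare : (¬ ∃ s : R, u = s ^ 2) →
      ({x : R | x ^ 2 = u}.ncard : ℝ) = √(q ^ k) * (0 : ℕ) := by
    intro hns
    have : {x : R | x ^ 2 = u} = ∅ := Set.eq_empty_of_forall_notMem fun x hx => hns ⟨x, hx.symm⟩
    simp [this]
  have hsqrt : 0 < √((q : ℝ) ^ k) := Real.sqrt_pos.2 (by positivity)
  refine ⟨fun hodd => ?_, fun heven hqo => ⟨?_, fun hns => ?_, ?_⟩⟩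
  · have hns : ¬ ∃ s : R, u = s ^ 2 := by
      rintro ⟨s, hs⟩
      obtain ⟨i, hi, -⟩ := h.level_of_sq_eq hu hu' hs.symm
      exact (Nat.not_even_iff_odd.2 hodd) ⟨i, by omega⟩
    rw [h.detCharpoly_productMatrix hu hu' hsqrt (Real.sq_sqrt (by positivity)) (nonsquare hns)
      (Nat.two_mul_div_two_of_even (hodd.add_one.mul_left _)).symm, pow_zero, mul_one,
      ← mul_assoc ((-1 : ℝ[X]) ^ q)]
  -- For odd `q` the number of nonzero eigenvalues is even.
  all_goals
    obtain ⟨i, rfl⟩ := even_iff_exists_two_mul.1 heven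
    have heq : Even (q ^ (n - 2 * i - 1) * (q - 1)) := (Nat.Odd.sub_odd hqo odd_one).mul_left _
    have hpos : 0 < q ^ (n - 2 * i - 1) * (q - 1) :=
      Nat.mul_pos (Nat.pow_pos (by omega)) (by omega)
  · rintro ⟨s, rfl⟩
    obtain ⟨j, hj, hs, hs'⟩ := h.level_of_sq_eq hu hu' rfl
    obtain rfl : i = j := by omega
    have hM := Nat.two_mul_div_two_of_even (heq.mul_right (2 * i + 1))
    have hM0 : 0 < q ^ (n - 2 * i - 1) * (q - 1) * (2 * i + 1) :=
      Nat.mul_pos hpos (Nat.succ_pos (2 * i))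
    rw [h.detCharpoly_productMatrix (c := (q : ℝ) ^ i) (t := 2)
      (b := q ^ (n - 2 * i - 1) * (q - 1) * (2 * i + 1) / 2 - 1) hu hu' (by positivity) (by ring)
      (by rw [h.ncard_sq_eq hqo hk hs hs']; push_cast; ring) (by omega), hqo.neg_one_pow,
      neg_one_mul, Nat.mul_div_cancel_left i two_pos]
  · rw [h.detCharpoly_productMatrix hu hu' hsqrt (Real.sq_sqrt (by positivity)) (nonsquare hns)
      (Nat.two_mul_div_two_of_even (heq.mul_right _)).symm, pow_zero, mul_one, hqo.neg_one_pow,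
      neg_one_mul]
  · exact h.ncard_squares hqo hk
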